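/- Let $n\ge 1$ be a fixed integer. For $M\in\mathbb{Z}_{\ge1}$ let $\Gamma_{M,n}$ be the set of doubly stochastic $n\times n$ matrices $\gamma=(\gamma(i,j))$ all of whose entries are integer multiples of $1/M$. Let $\mathcal{S}_{[n]}$ be the set of permutations of $[n]=\{1,\dots,n\}$ and, for $\sigma\in\mathcal{S}_{[n]}$, let $P_\sigma$ be the permutation matrix with $P_\sigma(i,j)=1$ if $\sigma(i)=j$ and $P_\sigma(i,j)=0$ otherwise. For $\gamma\in\Gamma_{M,n}$ define $$C_{M,n}(\gamma)=\Bigl|\Bigl\{(\sigma_1,\dots,\sigma_M)\in\mathcal{S}_{[n]}^M:\ \tfrac1M\sum_{m=1}^M P_{\sigma_m}=\gamma\Bigr\}\Bigr|,$$ $$C_{\mathrm{B},M,n}(\gamma)=(M!)^{2n-n^2}\prod_{i,j}\frac{(M-M\gamma(i,j))!}{(M\gamma(i,j))!},\qquad C_{\mathrm{scS},M,n}(\gamma)=M^{-nM}\,\frac{(M!)^{2n}}{\prod_{i,j}(M\gamma(i,j))!}.$$ With natural logarithms and the convention $0\log 0=0$, define for a doubly stochastic $n\times n$ matrix $\gamma$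 the modified Gibbs entropy $$H_{\mathrm G}'(\gamma)=\max_{p}\Bigl(-\sum_{\sigma\in\mathcal{S}_{[n]}}p(\sigma)\log p(\sigma)\Bigr),$$ where the maximum is over all probability mass functions $p$ on $\mathcal{S}_{[n]}$ such that $p(\sigma)=0$ unless $\gamma(i,\sigma(i))>0$ for all $i$, and such that $\sum_{\sigma}p(\sigma)P_\sigma=\gamma$; the Bethe entropy $$H_{\mathrm B}(\gamma)=-\sum_{i,j}\gamma(i,j)\log\gamma(i,j)+\sum_{i,j}(1-\gamma(i,j))\log(1-\gamma(i,j));$$ and the scaled Sinkhorn entropy $$H_{\mathrm{scS}}(\gamma)=-n-\sum_{i,j}\gamma(i,j)\log\gamma(i,j).$$ Then, for $\gamma\in\Gamma_{M,n}$ and $M\to\infty$, $$C_{M,n}(\gamma)=\exp\bigl(M\,H_{\mathrm G}'(\gamma)+o(M)\bigr),\quad C_{\mathrm{B},M,n}(\gamma)=\exp\bigl(M\,H_{\mathrm B}(\gamma)+o(M)\bigr),\quad C_{\mathrm{scS},M,n}(\gamma)=\exp\bigl(M\,H_{\mathrm{scS}}(\gamma)+o(M)\bigr),$$ where each $o(M)$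 is uniform in $\gamma$: it is bounded in absolute value, for all $M\ge1$ and all $\gamma\in\Gamma_{M,n}$, by a quantity $r(M)$ that depends only on $n$ and $M$ and satisfies $r(M)/M\to0$ as $M\to\infty$. -/

import Mathlib

noncomputable section

namespace PermanentCoefficients

/-- The set of doubly stochastic `n × n` matrices all of whose entries are integer multiples
of `1 / M`. -/
def gammaSet (M n : ℕ) : Set (Matrix (Fin n) (Fin n) ℝ) :=
  {γ | γ ∈ doublyStochastic ℝ (Fin n) ∧ ∀ i j, ∃ k : ℕ, (M : ℝ) * γ i j = k}

/-- The number of tuples `(σ_1, …, σ_M)` of permutations of `[n]` such that `γ` is the average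
of the permutation matrices of `σ_1, …, σ_M`. -/
def coeffGibbs (M n : ℕ) (γ : Matrix (Fin n) (Fin n) ℝ) : ℕ :=
  Set.ncard {σ : Fin M → Equiv.Perm (Fin n) |
    γ = (1 / (M : ℝ)) • ∑ m, (σ m).permMatrix ℝ}

/-- The natural number `M * γ(i,j)`; the floor is exact for `γ ∈ gammaSet M n`. -/
def mult (M : ℕ) {n : ℕ} (γ : Matrix (Fin n) (Fin n) ℝ) (i j : Fin n) : ℕ :=
  ⌊(M : ℝ) * γ i j⌋₊

/-- `(M!)^(2n - n²) * ∏_{i,j} (M - M γ(i,j))! / (M γ(i,j))!`, the exponent being an integer. -/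
def coeffBethe (M n : ℕ) (γ : Matrix (Fin n) (Fin n) ℝ) : ℝ :=
  (M.factorial : ℝ) ^ (2 * (n : ℤ) - (n : ℤ) ^ 2) *
    ∏ i, ∏ j, (((M - mult M γ i j).factorial : ℝ) / ((mult M γ i j).factorial : ℝ))

/-- `M^(-nM) * (M!)^(2n) / ∏_{i,j} (M γ(i,j))!`. -/
def coeffSinkhorn (M n : ℕ) (γ : Matrix (Fin n) (Fin n) ℝ) : ℝ :=
  (M : ℝ) ^ (-((n : ℤ) * (M : ℤ))) *
    ((M.factorial : ℝ) ^ (2 * n) / ∏ i, ∏ j, ((mult M γ i j).factorial : ℝ))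

/-- The permutations `σ` with `B(i, σ(i)) > 0` for all `i`. -/
def permSupport {n : ℕ} (B : Matrix (Fin n) (Fin n) ℝ) : Set (Equiv.Perm (Fin n)) :=
  {σ | ∀ i, 0 < B i (σ i)}

/-- Probability mass functions on the set of permutations (equivalently, of permutation
matrices) of `[n]` whose support is contained in `permSupport B`. -/
def pmfSet {n : ℕ} (B : Matrix (Fin n) (Fin n) ℝ) : Set (Equiv.Perm (Fin n) → ℝ) :=
  {p | (∀ σ, 0 ≤ p σ) ∧ (∀ σ, σ ∉ permSupport B → p σ = 0) ∧ ∑ σ, p σ = 1}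

/-- The elements of `pmfSet B` under which the mean of the random permutation matrix is `γ`. -/
def pmfSetMean {n : ℕ} (B γ : Matrix (Fin n) (Fin n) ℝ) : Set (Equiv.Perm (Fin n) → ℝ) :=
  {p | p ∈ pmfSet B ∧ ∑ σ, p σ • σ.permMatrix ℝ = γ}

/-- The Gibbs entropy function (`Real.log 0 = 0`, so that `0 * log 0 = 0`). -/
def gibbsEntropy {n : ℕ} (p : Equiv.Perm (Fin n) → ℝ) : ℝ :=
  -∑ σ, p σ * Real.log (p σ)

/-- The modified Gibbs entropy function: the maximum of the Gibbs entropy over the probability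
mass functions with support in `permSupport γ` and mean `γ`. The supremum is attained for every
doubly stochastic `γ`, see `isGreatest_modifiedGibbsEntropy`. -/
def modifiedGibbsEntropy {n : ℕ} (γ : Matrix (Fin n) (Fin n) ℝ) : ℝ :=
  sSup (gibbsEntropy '' pmfSetMean γ γ)

/-- The Bethe entropy function. -/
def betheEntropy {n : ℕ} (γ : Matrix (Fin n) (Fin n) ℝ) : ℝ :=
  -(∑ i, ∑ j, γ i j * Real.log (γ i j)) + ∑ i, ∑ j, (1 - γ i j) * Real.log (1 - γ i j)

/-- The scaled Sinkhorn entropy function. -/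
def sinkhornEntropy {n : ℕ} (γ : Matrix (Fin n) (Fin n) ℝ) : ℝ :=
  -(n : ℝ) - ∑ i, ∑ j, γ i j * Real.log (γ i j)

theorem isCompact_pmfSetMean {n : ℕ} (B γ : Matrix (Fin n) (Fin n) ℝ) :
    IsCompact (pmfSetMean B γ) := by
  have h : pmfSetMean B γ = stdSimplex ℝ (Equiv.Perm (Fin n)) ∩
      ({p | ∀ σ, σ ∉ permSupport B → p σ = 0} ∩ {p | ∑ σ, p σ • σ.permMatrix ℝ = γ}) := by
    ext p
    simp only [pmfSetMean, pmfSet, stdSimplex, Set.mem_ofPred_eq, Set.mem_inter_iff]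
    tauto
  rw [h]
  refine (isCompact_stdSimplex ℝ _).inter_right (IsClosed.inter ?_ ?_)
  · simp only [Set.ofPred_forall]
    refine isClosed_iInter fun σ => isClosed_iInter fun _ => ?_
    exact isClosed_eq (continuous_apply σ) continuous_const
  · refine isClosed_eq ?_ continuous_const
    exact continuous_finsetSum _ fun σ _ => (continuous_apply σ).smul continuous_const

theorem pmfSetMean_nonempty {n : ℕ} {γ : Matrix (Fin n) (Fin n) ℝ}
    (hγ : γ ∈ doublyStochastic ℝ (Fin n)) : (pmfSetMean γ γ).Nonempty := by
  obtain ⟨p, hp0, hp1, hp⟩ := exists_eq_sum_perm_of_mem_doublyStochastic hγ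
  refine ⟨p, ⟨hp0, fun σ hσ => ?_, hp1⟩, hp⟩
  simp only [permSupport, Set.mem_ofPred_eq, not_forall, not_lt] at hσ
  obtain ⟨i, hi⟩ := hσ
  refine le_antisymm (le_trans ?_ hi) (hp0 σ)
  have h1 : γ i (σ i) = ∑ τ, p τ * τ.permMatrix ℝ i (σ i) := by
    conv_lhs => rw [← hp]
    simp [Matrix.sum_apply]
  have hnn : ∀ τ : Equiv.Perm (Fin n), 0 ≤ p τ * τ.permMatrix ℝ i (σ i) := fun τ =>
    mul_nonneg (hp0 τ) (permMatrix_mem_doublyStochastic.1 _ _)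
  have h2 := Finset.single_le_sum (f := fun τ => p τ * τ.permMatrix ℝ i (σ i))
    (fun τ _ => hnn τ) (Finset.mem_univ σ)
  rw [h1]
  simpa [Equiv.Perm.permMatrix, PEquiv.toMatrix_apply] using h2

/-- The supremum in the definition of `modifiedGibbsEntropy` is a maximum. -/
theorem isGreatest_modifiedGibbsEntropy {n : ℕ} {γ : Matrix (Fin n) (Fin n) ℝ}
    (hγ : γ ∈ doublyStochastic ℝ (Fin n)) :
    IsGreatest (gibbsEntropy '' pmfSetMean γ γ) (modifiedGibbsEntropy γ) := by
  have hc : Continuous (gibbsEntropy (n := n)) := by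
    unfold gibbsEntropy
    exact (continuous_finsetSum _ fun σ _ =>
      Real.continuous_mul_log.comp (continuous_apply σ)).neg
  exact ((isCompact_pmfSetMean γ γ).image hc).isGreatest_sSup ((pmfSetMean_nonempty hγ).image _)

end PermanentCoefficients

end

namespace PermanentCoefficients

open Finset

/-! For `k ≤ M`, `log k!` equals `stirlingMain k` up to `1 + log M`. The Bethe and Sinkhorn
coefficients involve a number of factorials depending only on `n`; the line sums of `γ` make the `M
log M` terms cancel, leaving `M` times the entropy.

For the Gibbs coefficient, group tuples by type, the number of occurrences of each permutation. A
type `t` contains a multinomial number of tuples (`card_funs_with_fiber_card`), whose logarithm is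
`M` times the entropy of `t / M` up to `O(log M)`. Upper bound: there are at most `(M + 1) ^ n!`
types, and each one that occurs has mean `γ`, so its entropy is at most the maximum. Lower bound: a
single type suffices, obtained by rounding the maximizer. Flooring leaves an integer matrix with
constant line sums at most `n!`, which Birkhoff's theorem splits into permutations
(`exists_nat_approx`). All errors are `O(log M)`, with constants depending only on `n`. -/

/-! ### Stirling estimates -/

/-- The main term `x * log x - x` in Stirling's approximation of `log x!`. -/
noncomputable def stirlingMain (x : ℝ) : ℝ := x * Real.log x - x

/-- The single term `k ^ k / k!` of the exponential series is at most `exp k`. -/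
theorem stirlingMain_le_log_factorial (k : ℕ) :
    stirlingMain k ≤ Real.log (k.factorial : ℝ) := by
  rcases Nat.eq_zero_or_pos k with rfl | hk
  · simp [stirlingMain]
  have hk' : (0 : ℝ) < k := by exact_mod_cast hk
  have h := Real.log_le_log (by positivity) (Real.pow_div_factorial_le_exp (k : ℝ) hk'.le k)
  rw [Real.log_exp, Real.log_div (by positivity) (by positivity), Real.log_pow] at h
  unfold stirlingMain
  linarith

theorem log_factorial_le_stirlingMain (k : ℕ) :
    Real.log (k.factorial : ℝ) ≤ stirlingMain k + (1 + Real.log k) := by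
  rcases Nat.eq_zero_or_pos k with rfl | hk
  · simp [stirlingMain]
  induction k, hk using Nat.le_induction with
  | base => simp [stirlingMain]
  | succ k hk ih =>
    have hk' : (0 : ℝ) < k := by exact_mod_cast hk
    have h1 := Real.one_sub_inv_le_log_of_pos (x := ((k : ℝ) + 1) / k) (by positivity)
    rw [Real.log_div (by positivity) (by positivity)] at h1
    -- The induction step reduces to `(k + 1) * log ((k + 1) / k) ≥ 1`, which follows from `log x ≥
    -- 1 - 1 / x`.
    have h2 : ((k : ℝ) + 1) * (1 - (((k : ℝ) + 1) / k)⁻¹) = 1 := by field_simp; ring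
    have h3 := mul_le_mul_of_nonneg_left h1 (by positivity : (0 : ℝ) ≤ (k : ℝ) + 1)
    rw [Nat.factorial_succ]
    push_cast
    rw [Real.log_mul (by positivity) (by positivity)]
    unfold stirlingMain at *
    rw [h2] at h3
    linarith

theorem abs_log_factorial_sub_stirlingMain_le {k M : ℕ} (hk : k ≤ M) :
    |Real.log (k.factorial : ℝ) - stirlingMain k| ≤ 1 + Real.log M := by
  have h1 := stirlingMain_le_log_factorial k
  have h2 := log_factorial_le_stirlingMain k
  have h3 : Real.log k ≤ Real.log M := by
    rcases Nat.eq_zero_or_pos k with rfl | h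
    · simpa using Real.log_natCast_nonneg M
    · exact Real.log_le_log (by exact_mod_cast h) (by exact_mod_cast hk)
  rw [abs_of_nonneg] <;> linarith

theorem stirlingMain_mul {M : ℝ} (hM : 0 < M) (x : ℝ) :
    stirlingMain (M * x) = M * x * Real.log M + M * (x * Real.log x) - M * x := by
  unfold stirlingMain
  rcases eq_or_ne x 0 with rfl | hx
  · simp
  · rw [Real.log_mul hM.ne' hx]; ring

/-- `stirlingMain` falls from `0` to `-1` on `[0, 1]` and increases afterwards, so the slack `1` is
needed only for `k = 0`. -/
theorem stirlingMain_natCast_le {k : ℕ} {x : ℝ} (h : (k : ℝ) ≤ x) :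
    stirlingMain k ≤ stirlingMain x + 1 := by
  -- By convexity the graph lies above its tangent at `a`.
  have key : ∀ a : ℝ, 0 < a → 0 < x → x * Real.log a - a ≤ stirlingMain x := by
    intro a ha hx
    have h1 := Real.one_sub_inv_le_log_of_pos (x := x / a) (by positivity)
    rw [Real.log_div (by positivity) (by positivity), inv_div] at h1
    have h3 := mul_le_mul_of_nonneg_left h1 hx.le
    have h4 : x * (1 - a / x) = x - a := by field_simp
    unfold stirlingMain
    rw [h4] at h3
    linarith
  rcases Nat.eq_zero_or_pos k with rfl | hk
  · have hx0 : (0 : ℝ) ≤ x := by simpa using h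
    rcases hx0.eq_or_lt with rfl | hx
    · simp [stirlingMain]
    · have := key 1 one_pos hx
      simp [stirlingMain] at this ⊢
      linarith
  · have hk' : (1 : ℝ) ≤ k := by exact_mod_cast hk
    have h1 := key k (by linarith) (by linarith)
    have h2 : (k : ℝ) * Real.log k ≤ x * Real.log k :=
      mul_le_mul_of_nonneg_right h (Real.log_nonneg hk')
    have h3 : stirlingMain k = k * Real.log k - k := rfl
    linarith

theorem isLittleO_const_mul_one_add_log (c : ℝ) :
    (fun M : ℕ => c * (1 + Real.log M)) =o[Filter.atTop] (fun M : ℕ => (M : ℝ)) := by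
  refine Asymptotics.IsLittleO.const_mul_left ?_ c
  have h : (fun x : ℝ => 1 + Real.log x) =o[Filter.atTop] (fun x : ℝ => x) :=
    (Asymptotics.isLittleO_const_id_atTop 1).add Real.isLittleO_log_id_atTop
  exact h.comp_tendsto tendsto_natCast_atTop_atTop

theorem exists_eq_exp_add {C A r : ℝ} (hC : 0 < C) (h : |Real.log C - A| ≤ r) :
    ∃ δ : ℝ, |δ| ≤ r ∧ C = Real.exp (A + δ) :=
  ⟨Real.log C - A, h, by rw [add_sub_cancel, Real.exp_log hC]⟩

/-! ### The Sinkhorn and Bethe coefficients -/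

theorem natCast_mult {M n : ℕ} {γ : Matrix (Fin n) (Fin n) ℝ} (hγ : γ ∈ gammaSet M n)
    (i j : Fin n) : (mult M γ i j : ℝ) = M * γ i j := by
  obtain ⟨k, hk⟩ := hγ.2 i j
  rw [mult, hk, Nat.floor_natCast]

theorem mult_le {M n : ℕ} {γ : Matrix (Fin n) (Fin n) ℝ} (hγ : γ ∈ gammaSet M n)
    (i j : Fin n) : mult M γ i j ≤ M := by
  have h : (mult M γ i j : ℝ) ≤ M := by
    rw [natCast_mult hγ]
    exact mul_le_of_le_one_right (Nat.cast_nonneg M) (le_one_of_mem_doublyStochastic hγ.1)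
  exact_mod_cast h

theorem sum_sum_of_mem_doublyStochastic {n : ℕ} {γ : Matrix (Fin n) (Fin n) ℝ}
    (hγ : γ ∈ doublyStochastic ℝ (Fin n)) : ∑ i, ∑ j, γ i j = n := by
  simp [sum_row_of_mem_doublyStochastic hγ]

theorem abs_sum_sum_sub_le {n : ℕ} {f g : Fin n → Fin n → ℝ} {e : ℝ}
    (h : ∀ i j, |f i j - g i j| ≤ e) :
    |∑ i, ∑ j, f i j - ∑ i, ∑ j, g i j| ≤ (n : ℝ) ^ 2 * e := by
  calc |∑ i, ∑ j, f i j - ∑ i, ∑ j, g i j| = |∑ i, ∑ j, (f i j - g i j)| := by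
        simp only [sum_sub_distrib]
    _ ≤ ∑ _i : Fin n, ∑ _j : Fin n, e :=
        (abs_sum_le_sum_abs _ _).trans <| sum_le_sum fun i _ =>
          (abs_sum_le_sum_abs _ _).trans <| sum_le_sum fun j _ => h i j
    _ = (n : ℝ) ^ 2 * e := by simp; ring

theorem sum_stirlingMain_mul {M n : ℕ} (hM : 1 ≤ M) {γ : Matrix (Fin n) (Fin n) ℝ} {s : ℝ}
    (hs : ∑ i, ∑ j, γ i j = s) :
    ∑ i, ∑ j, stirlingMain (M * γ i j) =
      s * stirlingMain M + M * ∑ i, ∑ j, γ i j * Real.log (γ i j) := by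
  have hM' : (0 : ℝ) < M := by exact_mod_cast hM
  simp only [stirlingMain_mul hM', sum_sub_distrib, sum_add_distrib, ← mul_sum, ← sum_mul, hs]
  unfold stirlingMain
  ring

theorem abs_log_coeffSinkhorn_sub_le {M n : ℕ} (hM : 1 ≤ M) {γ : Matrix (Fin n) (Fin n) ℝ}
    (hγ : γ ∈ gammaSet M n) :
    |Real.log (coeffSinkhorn M n γ) - M * sinkhornEntropy γ| ≤
      (2 * n + (n : ℝ) ^ 2) * (1 + Real.log M) := by
  have hM' : (0 : ℝ) < M := by exact_mod_cast hM
  have hlog : Real.log (coeffSinkhorn M n γ) = -((n : ℝ) * M) * Real.log M +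
      (2 * n * Real.log (M.factorial : ℝ) -
        ∑ i, ∑ j, Real.log ((mult M γ i j).factorial : ℝ)) := by
    have hp : ∀ i j, ((mult M γ i j).factorial : ℝ) ≠ 0 := fun i j => by positivity
    have hp' : ∀ i, ∏ j, ((mult M γ i j).factorial : ℝ) ≠ 0 := fun i =>
      prod_ne_zero_iff.2 fun j _ => hp i j
    have hp'' : ∏ i, ∏ j, ((mult M γ i j).factorial : ℝ) ≠ 0 :=
      prod_ne_zero_iff.2 fun i _ => hp' i
    rw [coeffSinkhorn, Real.log_mul (by positivity) (div_ne_zero (by positivity) hp''),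
      Real.log_zpow, Real.log_div (by positivity) hp'', Real.log_pow,
      Real.log_prod fun i _ => hp' i]
    simp only [Real.log_prod fun j (_ : j ∈ univ) => hp _ j]
    push_cast
    ring
  have h1 := abs_log_factorial_sub_stirlingMain_le (le_refl M)
  have h2 := abs_sum_sum_sub_le fun i j =>
    abs_log_factorial_sub_stirlingMain_le (mult_le hγ i j)
  simp only [natCast_mult hγ] at h2
  rw [sum_stirlingMain_mul hM (sum_sum_of_mem_doublyStochastic hγ.1)] at h2
  have h3 : |2 * (n : ℝ) * (Real.log (M.factorial : ℝ) - stirlingMain M)| ≤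
      2 * n * (1 + Real.log M) := by
    rw [abs_mul, abs_of_nonneg (by positivity : (0 : ℝ) ≤ 2 * n)]
    exact mul_le_mul_of_nonneg_left h1 (by positivity)
  rw [hlog, add_mul]
  refine le_trans (le_of_eq ?_) ((abs_sub _ _).trans (add_le_add h3 h2))
  congr 1
  -- What remains besides the entropy sum is `-n * M * log M + (2 * n - n) * stirlingMain M = -n *
  -- M`.
  simp only [sinkhornEntropy, stirlingMain]
  ring

theorem coeffSinkhorn_pos {M n : ℕ} (hM : 1 ≤ M) (γ : Matrix (Fin n) (Fin n) ℝ) :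
    0 < coeffSinkhorn M n γ := by
  have hM' : (0 : ℝ) < M := by exact_mod_cast hM
  unfold coeffSinkhorn
  have : 0 < ∏ i, ∏ j, ((mult M γ i j).factorial : ℝ) :=
    prod_pos fun i _ => prod_pos fun j _ => by positivity
  positivity

theorem abs_log_coeffBethe_sub_le {M n : ℕ} (hM : 1 ≤ M) {γ : Matrix (Fin n) (Fin n) ℝ}
    (hγ : γ ∈ gammaSet M n) :
    |Real.log (coeffBethe M n γ) - M * betheEntropy γ| ≤
      (|2 * (n : ℝ) - (n : ℝ) ^ 2| + (n : ℝ) ^ 2 + (n : ℝ) ^ 2) * (1 + Real.log M) := by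
  have hlog : Real.log (coeffBethe M n γ) =
      (2 * (n : ℝ) - (n : ℝ) ^ 2) * Real.log (M.factorial : ℝ) +
      (∑ i, ∑ j, Real.log ((M - mult M γ i j).factorial : ℝ) -
        ∑ i, ∑ j, Real.log ((mult M γ i j).factorial : ℝ)) := by
    have hp : ∀ i j, (((M - mult M γ i j).factorial : ℝ) / ((mult M γ i j).factorial : ℝ)) ≠ 0 :=
      fun i j => by positivity
    have hp' : ∀ i, ∏ j, (((M - mult M γ i j).factorial : ℝ) /
        ((mult M γ i j).factorial : ℝ)) ≠ 0 := fun i => prod_ne_zero_iff.2 fun j _ => hp i j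
    rw [coeffBethe, Real.log_mul (by positivity) (prod_ne_zero_iff.2 fun i _ => hp' i),
      Real.log_zpow, Real.log_prod fun i _ => hp' i]
    simp only [Real.log_prod fun j (_ : j ∈ univ) => hp _ j, ← sum_sub_distrib]
    push_cast
    congr 1
    refine sum_congr rfl fun i _ => sum_congr rfl fun j _ => ?_
    rw [Real.log_div (by positivity) (by positivity)]
  have h1 := abs_log_factorial_sub_stirlingMain_le (le_refl M)
  have h2 := abs_sum_sum_sub_le fun i j =>
    abs_log_factorial_sub_stirlingMain_le (mult_le hγ i j)
  have h2' := abs_sum_sum_sub_le fun i j =>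
    abs_log_factorial_sub_stirlingMain_le (Nat.sub_le M (mult M γ i j))
  have hcast : ∀ i j, ((M - mult M γ i j : ℕ) : ℝ) = M * (1 - γ i j) := fun i j => by
    rw [Nat.cast_sub (mult_le hγ i j), natCast_mult hγ]; ring
  simp only [natCast_mult hγ] at h2
  simp only [hcast] at h2'
  have hs := sum_sum_of_mem_doublyStochastic hγ.1
  have hs' : ∑ i, ∑ j, (1 - γ i j) = (n : ℝ) ^ 2 - n := by
    simp [sum_sub_distrib, hs]; ring
  rw [sum_stirlingMain_mul hM hs] at h2
  rw [sum_stirlingMain_mul (γ := fun i j => 1 - γ i j) hM hs'] at h2'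
  have h3 : |(2 * (n : ℝ) - (n : ℝ) ^ 2) * (Real.log (M.factorial : ℝ) - stirlingMain M)| ≤
      |2 * (n : ℝ) - (n : ℝ) ^ 2| * (1 + Real.log M) := by
    rw [abs_mul]
    exact mul_le_mul_of_nonneg_left h1 (abs_nonneg _)
  rw [hlog, add_mul, add_mul]
  refine le_trans (le_of_eq ?_) ((abs_sub _ _).trans
    (add_le_add ((abs_add_le _ _).trans (add_le_add h3 h2')) h2))
  -- The multiples of `stirlingMain M` cancel: `(2n - n²) + (n² - n) - n = 0`.
  congr 1
  simp only [betheEntropy]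
  ring

theorem coeffBethe_pos (M n : ℕ) (γ : Matrix (Fin n) (Fin n) ℝ) : 0 < coeffBethe M n γ := by
  unfold coeffBethe
  have : 0 < ∏ i, ∏ j, (((M - mult M γ i j).factorial : ℝ) / ((mult M γ i j).factorial : ℝ)) :=
    prod_pos fun i _ => prod_pos fun j _ => by positivity
  positivity

/-! ### Counting tuples of a given type -/

/-- Orbit-stabilizer: permutations of `α` act transitively on the functions with these fiber sizes,
and a stabilizer has order `∏ s, (t s)!`. -/
theorem card_funs_with_fiber_card {α S : Type*} [Fintype α] [DecidableEq α] [Fintype S]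
    [DecidableEq S] (t : S → ℕ) (ht : ∑ s, t s = Fintype.card α) :
    #{f : α → S | ∀ s, #{a | f a = s} = t s} * ∏ s, (t s).factorial =
      (Fintype.card α).factorial := by
  obtain ⟨e⟩ : Nonempty (α ≃ Σ s, Fin (t s)) :=
    Fintype.card_eq.1 (by simp [ht])
  let f₀ : α → S := fun a => (e a).1
  have hf₀ : ∀ s, #{a | f₀ a = s} = t s := fun s => by
    rw [← Fintype.card_subtype]
    have e1 : {a // f₀ a = s} ≃ Fin (t s) :=
      (e.subtypeEquiv (q := fun x => x.1 = s) fun a => Iff.rfl).trans (Equiv.sigmaSubtype s)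
    simpa using Fintype.card_congr e1
  have hmap : ∀ g ∈ (univ : Finset (Equiv.Perm α)),
      f₀ ∘ g ∈ ({f : α → S | ∀ s, #{a | f a = s} = t s} : Finset (α → S)) := by
    intro g _
    rw [mem_filter_univ]
    intro s
    rw [← hf₀ s]
    exact card_bij (fun a _ => g a) (by simp) (by simp) fun b hb => ⟨g.symm b, by simpa using hb⟩
  have hfib : ∀ f ∈ ({f : α → S | ∀ s, #{a | f a = s} = t s} : Finset (α → S)),
      #{g : Equiv.Perm α | f₀ ∘ g = f} = ∏ s, (t s).factorial := by
    intro f hf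
    rw [mem_filter_univ] at hf
    have hcard : ∀ s, Nonempty ({a // f a = s} ≃ {a // f₀ a = s}) := fun s =>
      Fintype.card_eq.1 (by rw [Fintype.card_subtype, Fintype.card_subtype, hf, hf₀])
    let g₀ : Equiv.Perm α := Equiv.ofFiberEquiv fun s => (hcard s).some
    have hg₀ : ∀ a, f₀ (g₀ a) = f a := fun a => Equiv.ofFiberEquiv_map _ a
    have hstab := DomMulAct.stabilizer_card f₀
    rw [Fintype.card_subtype] at hstab
    simp only [Fintype.card_subtype, hf₀] at hstab
    rw [← hstab]
    -- Since `f₀ ∘ g₀ = f`, the fiber over `f` is the coset of the stabilizer of `f₀` through `g₀`.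
    refine card_bij (fun g _ => g * g₀⁻¹) ?_ (by simp) ?_
    · intro g hg
      rw [mem_filter_univ] at hg ⊢
      ext a
      have := congrFun hg (g₀⁻¹ a)
      simp only [Function.comp_apply, Equiv.Perm.mul_apply] at this ⊢
      rw [this, ← hg₀]; simp
    · intro g hg
      rw [mem_filter_univ] at hg
      refine ⟨g * g₀, ?_, by simp⟩
      rw [mem_filter_univ]
      ext a
      rw [← hg₀]
      exact congrFun hg (g₀ a)
  rw [← Fintype.card_perm, ← card_univ, card_eq_sum_card_fiberwise hmap, sum_congr rfl hfib,
    sum_const, smul_eq_mul]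

theorem log_card_funs_with_fiber_card {M : ℕ} {S : Type*} [Fintype S] [DecidableEq S]
    {t : S → ℕ} (ht : ∑ s, t s = M) :
    0 < #{f : Fin M → S | ∀ s, #{a | f a = s} = t s} ∧
    Real.log (#{f : Fin M → S | ∀ s, #{a | f a = s} = t s} : ℝ) =
      Real.log (M.factorial : ℝ) - ∑ s, Real.log ((t s).factorial : ℝ) := by
  have h := card_funs_with_fiber_card (α := Fin M) t (by simpa using ht)
  rw [Fintype.card_fin] at h
  have hpos : 0 < #{f : Fin M → S | ∀ s, #{a | f a = s} = t s} :=
    Nat.pos_of_ne_zero fun h0 => by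
      rw [h0, zero_mul] at h
      exact (Nat.factorial_pos M).ne h
  refine ⟨hpos, ?_⟩
  have hpos' : (0 : ℝ) < #{f : Fin M → S | ∀ s, #{a | f a = s} = t s} := by exact_mod_cast hpos
  rw [← h]
  push_cast
  rw [Real.log_mul hpos'.ne' (prod_ne_zero_iff.2 fun s _ => by positivity),
    Real.log_prod fun s _ => by positivity]
  ring

theorem sum_stirlingMain_mul_eq_sub_gibbsEntropy {M n : ℕ} (hM : 1 ≤ M)
    {p : Equiv.Perm (Fin n) → ℝ} (hp : ∑ σ, p σ = 1) :
    ∑ σ, stirlingMain (M * p σ) = stirlingMain M - M * gibbsEntropy p := by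
  have hM' : (0 : ℝ) < M := by exact_mod_cast hM
  simp only [stirlingMain_mul hM', sum_sub_distrib, sum_add_distrib, ← mul_sum, ← sum_mul, hp]
  unfold stirlingMain gibbsEntropy
  ring

/-- The support condition is automatic: `p σ` is one of the nonnegative terms summing to `γ i (σ
i)`. -/
theorem mem_pmfSetMean_self {n : ℕ} {γ : Matrix (Fin n) (Fin n) ℝ}
    {p : Equiv.Perm (Fin n) → ℝ} (hp0 : ∀ σ, 0 ≤ p σ) (hp1 : ∑ σ, p σ = 1)
    (hp : ∑ σ, p σ • σ.permMatrix ℝ = γ) : p ∈ pmfSetMean γ γ := by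
  refine ⟨⟨hp0, fun σ hσ => ?_, hp1⟩, hp⟩
  simp only [permSupport, Set.mem_ofPred_eq, not_forall, not_lt] at hσ
  obtain ⟨i, hi⟩ := hσ
  refine le_antisymm (le_trans ?_ hi) (hp0 σ)
  rw [← hp, Matrix.sum_apply]
  have h := single_le_sum (f := fun τ : Equiv.Perm (Fin n) => (p τ • τ.permMatrix ℝ) i (σ i))
    (fun τ _ => mul_nonneg (hp0 τ) (permMatrix_mem_doublyStochastic.1 _ _)) (mem_univ σ)
  simpa using h

/-! ### Integral decompositions and rounding -/

/-- A matrix of natural numbers with all row and column sums equal to `K` is a sum of `K`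
permutation matrices. -/
theorem exists_perm_decomposition {n : ℕ} (K : ℕ) (A : Fin n → Fin n → ℕ)
    (hr : ∀ i, ∑ j, A i j = K) (hc : ∀ j, ∑ i, A i j = K) :
    ∃ t : Equiv.Perm (Fin n) → ℕ, ∑ σ, t σ = K ∧
      ∀ i j, A i j = ∑ σ, if σ i = j then t σ else 0 := by
  induction K generalizing A with
  | zero =>
    refine ⟨0, by simp, fun i j => ?_⟩
    have := (sum_eq_zero_iff.1 (hr i)) j (mem_univ j)
    simpa using this
  | succ K ih =>
    have hK : (0 : ℝ) < (K : ℝ) + 1 := by positivity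
    have hγ : (Matrix.of fun i j => (A i j : ℝ) / (K + 1)) ∈ doublyStochastic ℝ (Fin n) := by
      rw [mem_doublyStochastic_iff_sum]
      refine ⟨fun i j => by simp only [Matrix.of_apply]; positivity, fun i => ?_, fun j => ?_⟩
      · simp only [Matrix.of_apply, ← sum_div]
        rw [div_eq_one_iff_eq hK.ne']
        exact_mod_cast hr i
      · simp only [Matrix.of_apply, ← sum_div]
        rw [div_eq_one_iff_eq hK.ne']
        exact_mod_cast hc j
    -- Birkhoff's theorem for `A / (K + 1)` yields a permutation on which `A` is positive; peel it
    -- off and induct.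
    obtain ⟨p, ⟨_, hpS, hp1⟩, _⟩ := pmfSetMean_nonempty hγ
    obtain ⟨σ, hσ⟩ : ∃ σ, σ ∈ permSupport (Matrix.of fun i j => (A i j : ℝ) / (K + 1)) := by
      by_contra! h
      rw [sum_eq_zero fun σ _ => hpS σ (h σ)] at hp1
      exact zero_ne_one hp1
    have hσ' : ∀ i, 0 < A i (σ i) := fun i => by
      have h := hσ i
      rw [Matrix.of_apply, div_pos_iff_of_pos_right hK] at h
      exact_mod_cast h
    have hA : ∀ i j, A i j = (A i j - if σ i = j then 1 else 0) + if σ i = j then 1 else 0 := by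
      intro i j
      split_ifs with h
      · have := hσ' i
        rw [h] at this
        omega
      · simp
    obtain ⟨t, ht, hAt⟩ := ih (fun i j => A i j - if σ i = j then 1 else 0)
      (fun i => by
        have h := hr i
        rw [sum_congr rfl fun j _ => hA i j, sum_add_distrib] at h
        simpa using h)
      (fun j => by
        have h := hc j
        rw [sum_congr rfl fun i _ => hA i j, sum_add_distrib] at h
        simpa [← Equiv.eq_symm_apply] using h)
    refine ⟨fun τ => t τ + if τ = σ then 1 else 0, by simp [sum_add_distrib, ht], fun i j => ?_⟩
    rw [hA, hAt]
    have : ∀ τ : Equiv.Perm (Fin n), (if τ i = j then t τ + (if τ = σ then 1 else 0) else 0) =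
        (if τ i = j then t τ else 0) + if τ = σ then (if τ i = j then 1 else 0) else 0 := by
      intro τ
      split_ifs <;> simp
    simp only [this, sum_add_distrib, sum_ite_eq', mem_univ, if_true]

/-- Every probability mass function with mean `γ ∈ gammaSet M n` is, after scaling by `M`,
close to an integral one with the same mean. -/
theorem exists_nat_approx {M n : ℕ} {γ : Matrix (Fin n) (Fin n) ℝ}
    (hγ : γ ∈ gammaSet M n) {p : Equiv.Perm (Fin n) → ℝ} (hp : p ∈ pmfSetMean γ γ) :
    ∃ t : Equiv.Perm (Fin n) → ℕ, ∑ σ, t σ ≤ Fintype.card (Equiv.Perm (Fin n)) ∧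
      ∑ σ, (⌊(M : ℝ) * p σ⌋₊ + t σ) = M ∧
      ∑ σ, ((⌊(M : ℝ) * p σ⌋₊ + t σ : ℕ) : ℝ) • σ.permMatrix ℝ = (M : ℝ) • γ := by
  obtain ⟨⟨hp0, _, hp1⟩, hpγ⟩ := hp
  set q : Equiv.Perm (Fin n) → ℕ := fun σ => ⌊(M : ℝ) * p σ⌋₊ with hq
  have hqle : ∀ σ, (q σ : ℝ) ≤ M * p σ := fun σ =>
    Nat.floor_le (mul_nonneg (Nat.cast_nonneg M) (hp0 σ))
  have hlt : ∀ σ, (M : ℝ) * p σ ≤ q σ + 1 := fun σ => (Nat.lt_floor_add_one _).le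
  have hsum : ∑ σ, (M : ℝ) * p σ = M := by rw [← mul_sum, hp1, mul_one]
  have hqM : ∑ σ, q σ ≤ M := by
    have h : ((∑ σ, q σ : ℕ) : ℝ) ≤ M := by
      rw [← hsum]; push_cast; exact sum_le_sum fun σ _ => hqle σ
    exact_mod_cast h
  -- Each floor loses at most `1`, so the missing mass is at most the number of permutations.
  have hMq : M ≤ ∑ σ, q σ + Fintype.card (Equiv.Perm (Fin n)) := by
    have h : (M : ℝ) ≤ ((∑ σ, q σ + Fintype.card (Equiv.Perm (Fin n)) : ℕ) : ℝ) := by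
      calc (M : ℝ) = ∑ σ, (M : ℝ) * p σ := hsum.symm
        _ ≤ ∑ σ, ((q σ : ℝ) + 1) := sum_le_sum fun σ _ => hlt σ
        _ = _ := by rw [sum_add_distrib]; push_cast; simp
    exact_mod_cast h
  have hγe : ∀ i j, γ i j = ∑ σ, if σ i = j then p σ else 0 := fun i j => by
    rw [← hpγ, Matrix.sum_apply]
    simp
  have hle : ∀ i j, (∑ σ, if σ i = j then q σ else 0) ≤ mult M γ i j := fun i j => by
    have h : ((∑ σ, if σ i = j then q σ else 0 : ℕ) : ℝ) ≤ (mult M γ i j : ℝ) := by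
      rw [natCast_mult hγ, hγe, mul_sum]
      push_cast
      refine sum_le_sum fun σ _ => ?_
      split_ifs
      · exact hqle σ
      · simp
    exact_mod_cast h
  have hrow : ∀ i, ∑ j, mult M γ i j = M := fun i => by
    have h : ((∑ j, mult M γ i j : ℕ) : ℝ) = M := by
      push_cast
      simp only [natCast_mult hγ, ← mul_sum, sum_row_of_mem_doublyStochastic hγ.1, mul_one]
    exact_mod_cast h
  have hcol : ∀ j, ∑ i, mult M γ i j = M := fun j => by
    have h : ((∑ i, mult M γ i j : ℕ) : ℝ) = M := by
      push_cast
      simp only [natCast_mult hγ, ← mul_sum, sum_col_of_mem_doublyStochastic hγ.1, mul_one]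
    exact_mod_cast h
  -- The floored permutations contribute `∑ σ, q σ` to every line, so the remainder still has
  -- constant line sums.
  obtain ⟨t, ht, hA⟩ := exists_perm_decomposition (M - ∑ σ, q σ)
    (fun i j => mult M γ i j - ∑ σ, if σ i = j then q σ else 0)
    (fun i => by
      rw [sum_tsub_distrib _ fun j _ => hle i j, hrow, sum_comm]
      simp)
    (fun j => by
      rw [sum_tsub_distrib _ fun i _ => hle i j, hcol, sum_comm]
      simp [← Equiv.eq_symm_apply])
  refine ⟨t, by omega, show ∑ σ, (q σ + t σ) = M by
    rw [sum_add_distrib, ht]; omega, ?_⟩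
  ext i j
  have h : mult M γ i j = ∑ σ, if σ i = j then q σ + t σ else 0 := by
    have h1 := hA i j
    have h2 := hle i j
    have h3 : (∑ σ : Equiv.Perm (Fin n), if σ i = j then q σ + t σ else 0) =
        (∑ σ : Equiv.Perm (Fin n), if σ i = j then q σ else 0) +
          ∑ σ : Equiv.Perm (Fin n), if σ i = j then t σ else 0 := by
      rw [← sum_add_distrib]
      exact sum_congr rfl fun σ _ => by split_ifs <;> simp
    omega
  rw [Matrix.sum_apply, Matrix.smul_apply, smul_eq_mul, ← natCast_mult hγ, h]
  push_cast
  simp [hq]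

/-! ### Bounds for the Gibbs coefficient -/

theorem sum_permMatrix_eq_sum_card_smul {M n : ℕ} (f : Fin M → Equiv.Perm (Fin n)) :
    ∑ m, (f m).permMatrix ℝ = ∑ σ, (#{m | f m = σ} : ℝ) • σ.permMatrix ℝ := by
  rw [← sum_fiberwise univ f]
  refine sum_congr rfl fun σ _ => ?_
  rw [sum_congr rfl fun m hm => by rw [(mem_filter.1 hm).2], sum_const, Nat.cast_smul_eq_nsmul]

open Classical in
theorem coeffGibbs_eq_card (M n : ℕ) (γ : Matrix (Fin n) (Fin n) ℝ) :
    coeffGibbs M n γ = #{f : Fin M → Equiv.Perm (Fin n) |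
      γ = (1 / (M : ℝ)) • ∑ m, (f m).permMatrix ℝ} := by
  rw [coeffGibbs, ← Set.ncard_coe_finset]
  simp

/-- Passing from `a!` to `(a + b)!` multiplies by `b` factors, each at most `M`. This prices the
correction `t` added to the floors. -/
theorem log_factorial_add_le {a b M : ℕ} (hM : 1 ≤ M) (h : a + b ≤ M) :
    Real.log ((a + b).factorial : ℝ) ≤ Real.log (a.factorial : ℝ) + b * Real.log M := by
  have h1 : (a + b).factorial ≤ a.factorial * M ^ b := by
    rw [← Nat.factorial_mul_ascFactorial]
    exact Nat.mul_le_mul_left _ ((Nat.ascFactorial_le_pow_add a b).trans (Nat.pow_le_pow_left h b))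
  have hM' : (0 : ℝ) < M := by exact_mod_cast hM
  rw [← Real.log_pow, ← Real.log_mul (by positivity) (by positivity)]
  exact Real.log_le_log (by positivity) (by exact_mod_cast h1)

theorem le_log_coeffGibbs {M n : ℕ} (hM : 1 ≤ M) {γ : Matrix (Fin n) (Fin n) ℝ}
    (hγ : γ ∈ gammaSet M n) :
    0 < coeffGibbs M n γ ∧ M * modifiedGibbsEntropy γ -
      3 * Fintype.card (Equiv.Perm (Fin n)) * (1 + Real.log M) ≤ Real.log (coeffGibbs M n γ) := by
  classical
  have hM' : (0 : ℝ) < M := by exact_mod_cast hM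
  have hL : 0 ≤ Real.log M := Real.log_natCast_nonneg M
  obtain ⟨p, hp, hpH⟩ := (isGreatest_modifiedGibbsEntropy hγ.1).1
  obtain ⟨t, htN, htM, htγ⟩ := exists_nat_approx hγ hp
  obtain ⟨hpos, hlog⟩ := log_card_funs_with_fiber_card htM
  have hle : #{f : Fin M → Equiv.Perm (Fin n) |
      ∀ σ, #{a | f a = σ} = ⌊(M : ℝ) * p σ⌋₊ + t σ} ≤ coeffGibbs M n γ := by
    rw [coeffGibbs_eq_card]
    refine card_le_card fun f hf => ?_
    rw [mem_filter_univ] at hf ⊢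
    rw [sum_permMatrix_eq_sum_card_smul]
    simp only [hf, htγ, smul_smul]
    rw [one_div, inv_mul_cancel₀ hM'.ne', one_smul]
  refine ⟨hpos.trans_le hle, ?_⟩
  refine le_trans ?_ (Real.log_le_log (Nat.cast_pos.2 hpos) (Nat.cast_le.2 hle))
  -- The constant `2` is `1` from Stirling plus `1` from replacing the floor by `M * p σ`.
  have hterm : ∀ σ, Real.log ((⌊(M : ℝ) * p σ⌋₊ + t σ).factorial : ℝ) ≤
      stirlingMain (M * p σ) + (2 + Real.log M) + t σ * Real.log M := fun σ => by
    have hb : ⌊(M : ℝ) * p σ⌋₊ + t σ ≤ M := by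
      conv_rhs => rw [← htM]
      exact single_le_sum (f := fun σ => ⌊(M : ℝ) * p σ⌋₊ + t σ) (fun _ _ => Nat.zero_le _)
        (mem_univ σ)
    have h1 := log_factorial_add_le hM hb
    have h2 := (abs_le.1 (abs_log_factorial_sub_stirlingMain_le
      ((Nat.le_add_right _ _).trans hb))).2
    have h3 := stirlingMain_natCast_le
      (Nat.floor_le (mul_nonneg (Nat.cast_nonneg M) (hp.1.1 σ)))
    linarith
  have hsum := sum_le_sum fun σ (_ : σ ∈ univ) => hterm σ
  rw [sum_add_distrib, sum_add_distrib, sum_stirlingMain_mul_eq_sub_gibbsEntropy hM hp.1.2.2,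
    ← sum_mul, sum_const, card_univ, nsmul_eq_mul, hpH] at hsum
  have htN' : (∑ σ, (t σ : ℝ)) * Real.log M ≤
      Fintype.card (Equiv.Perm (Fin n)) * Real.log M :=
    mul_le_mul_of_nonneg_right (by exact_mod_cast htN) hL
  have hS := stirlingMain_le_log_factorial M
  have hN : (0 : ℝ) ≤ Fintype.card (Equiv.Perm (Fin n)) := Nat.cast_nonneg _
  have hNL := mul_nonneg hN hL
  rw [hlog]
  linarith

theorem coeffGibbs_le {M n : ℕ} (hM : 1 ≤ M) {γ : Matrix (Fin n) (Fin n) ℝ}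
    (hγ : γ ∈ gammaSet M n) :
    (coeffGibbs M n γ : ℝ) ≤ ((M : ℝ) + 1) ^ Fintype.card (Equiv.Perm (Fin n)) *
      Real.exp (M * modifiedGibbsEntropy γ + (1 + Real.log M)) := by
  classical
  have hM' : (0 : ℝ) < M := by exact_mod_cast hM
  set C : Finset (Fin M → Equiv.Perm (Fin n)) :=
    {f | γ = (1 / (M : ℝ)) • ∑ m, (f m).permMatrix ℝ} with hC
  let count : (Fin M → Equiv.Perm (Fin n)) → Equiv.Perm (Fin n) → ℕ := fun f σ => #{m | f m = σ}
  have hmap : ∀ f ∈ C, count f ∈ Fintype.piFinset fun _ : Equiv.Perm (Fin n) => range (M + 1) := by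
    intro f _
    rw [Fintype.mem_piFinset]
    intro σ
    rw [mem_range]
    have := card_le_univ ({m | f m = σ} : Finset (Fin M))
    rw [Fintype.card_fin] at this
    exact Nat.lt_succ_of_le this
  have hfib : ∀ t ∈ Fintype.piFinset fun _ : Equiv.Perm (Fin n) => range (M + 1),
      (#{f ∈ C | count f = t} : ℝ) ≤
        Real.exp (M * modifiedGibbsEntropy γ + (1 + Real.log M)) := by
    intro t _
    -- Only a type realized by some tuple in `C` is known to have mean `γ`; the other fibers are
    -- empty.
    rcases ({f ∈ C | count f = t} : Finset _).eq_empty_or_nonempty with h0 | ⟨f, hf⟩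
    · rw [h0, card_empty, Nat.cast_zero]
      exact (Real.exp_pos _).le
    rw [mem_filter, hC, mem_filter_univ, sum_permMatrix_eq_sum_card_smul] at hf
    obtain ⟨hf, rfl⟩ := hf
    have htM : ∑ σ, count f σ = M := by
      rw [← card_eq_sum_card_fiberwise (f := f) (s := univ) (t := univ) (fun _ _ => by simp),
        card_univ, Fintype.card_fin]
    have hp1 : ∑ σ, (count f σ : ℝ) / M = 1 := by
      rw [← sum_div, div_eq_one_iff_eq hM'.ne']
      exact_mod_cast htM
    have hp : (fun σ => (count f σ : ℝ) / M) ∈ pmfSetMean γ γ := by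
      refine mem_pmfSetMean_self (fun σ => by positivity) hp1 ?_
      rw [hf, smul_sum]
      refine sum_congr rfl fun σ _ => ?_
      rw [smul_smul, one_div, div_eq_inv_mul]
    have hH := (isGreatest_modifiedGibbsEntropy hγ.1).2 (Set.mem_image_of_mem _ hp)
    obtain ⟨hpos, hlog⟩ := log_card_funs_with_fiber_card htM
    have hS := sum_stirlingMain_mul_eq_sub_gibbsEntropy hM hp1
    simp only [mul_div_cancel₀ _ hM'.ne'] at hS
    have h1 := sum_le_sum fun σ (_ : σ ∈ univ) => stirlingMain_le_log_factorial (count f σ)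
    have h2 := log_factorial_le_stirlingMain M
    have hle : #{g ∈ C | count g = count f} ≤
        #{g : Fin M → Equiv.Perm (Fin n) | ∀ σ, #{a | g a = σ} = count f σ} := by
      refine card_le_card fun g hg => ?_
      rw [mem_filter_univ]
      exact fun σ => congrFun (mem_filter.1 hg).2 σ
    refine le_trans (Nat.cast_le.2 hle) ?_
    rw [← Real.log_le_iff_le_exp (by exact_mod_cast hpos), hlog]
    have h3 := mul_le_mul_of_nonneg_left hH hM'.le
    linarith
  rw [coeffGibbs_eq_card, ← hC, card_eq_sum_card_fiberwise hmap]
  push_cast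
  refine (sum_le_sum hfib).trans (le_of_eq ?_)
  rw [sum_const, nsmul_eq_mul, Fintype.card_piFinset]
  simp

theorem abs_log_coeffGibbs_sub_le {M n : ℕ} (hM : 1 ≤ M) {γ : Matrix (Fin n) (Fin n) ℝ}
    (hγ : γ ∈ gammaSet M n) :
    |Real.log (coeffGibbs M n γ) - M * modifiedGibbsEntropy γ| ≤
      (3 * Fintype.card (Equiv.Perm (Fin n)) + 1) * (1 + Real.log M) := by
  have hM' : (1 : ℝ) ≤ M := by exact_mod_cast hM
  have hL : 0 ≤ Real.log M := Real.log_natCast_nonneg M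
  obtain ⟨hpos, hlow⟩ := le_log_coeffGibbs hM hγ
  have hup := Real.log_le_log (by exact_mod_cast hpos) (coeffGibbs_le hM hγ)
  rw [Real.log_mul (by positivity) (by positivity), Real.log_exp, Real.log_pow] at hup
  have h1 : Real.log ((M : ℝ) + 1) ≤ 1 + Real.log M := by
    have h := Real.log_le_log (by positivity) (by linarith : (M : ℝ) + 1 ≤ 2 * M)
    rw [Real.log_mul (by norm_num) (by positivity)] at h
    linarith [Real.log_two_lt_d9]
  have hN : (0 : ℝ) ≤ Fintype.card (Equiv.Perm (Fin n)) := Nat.cast_nonneg _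
  have h2 := mul_le_mul_of_nonneg_left h1 hN
  have h3 := mul_nonneg hN (by linarith : 0 ≤ 1 + Real.log (M : ℝ))
  rw [abs_le]
  constructor <;> linarith

end PermanentCoefficients

open PermanentCoefficients in
theorem mainTheorem4 (n : ℕ) (hn : 1 ≤ n) :
    (∃ r : ℕ → ℝ, r =o[Filter.atTop] (fun M : ℕ => (M : ℝ)) ∧
      ∀ M : ℕ, 1 ≤ M → ∀ γ ∈ gammaSet M n, ∃ δ : ℝ, |δ| ≤ r M ∧
        (coeffGibbs M n γ : ℝ) = Real.exp (M * modifiedGibbsEntropy γ + δ)) ∧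
    (∃ r : ℕ → ℝ, r =o[Filter.atTop] (fun M : ℕ => (M : ℝ)) ∧
      ∀ M : ℕ, 1 ≤ M → ∀ γ ∈ gammaSet M n, ∃ δ : ℝ, |δ| ≤ r M ∧
        coeffBethe M n γ = Real.exp (M * betheEntropy γ + δ)) ∧
    (∃ r : ℕ → ℝ, r =o[Filter.atTop] (fun M : ℕ => (M : ℝ)) ∧
      ∀ M : ℕ, 1 ≤ M → ∀ γ ∈ gammaSet M n, ∃ δ : ℝ, |δ| ≤ r M ∧
        coeffSinkhorn M n γ = Real.exp (M * sinkhornEntropy γ + δ)) := by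
  refine ⟨⟨_, isLittleO_const_mul_one_add_log (3 * Fintype.card (Equiv.Perm (Fin n)) + 1), ?_⟩,
    ⟨_, isLittleO_const_mul_one_add_log
      (|2 * (n : ℝ) - (n : ℝ) ^ 2| + (n : ℝ) ^ 2 + (n : ℝ) ^ 2), ?_⟩,
    ⟨_, isLittleO_const_mul_one_add_log (2 * n + (n : ℝ) ^ 2), ?_⟩⟩
  · exact fun M hM γ hγ => exists_eq_exp_add (by exact_mod_cast (le_log_coeffGibbs hM hγ).1)
      (abs_log_coeffGibbs_sub_le hM hγ)
  · exact fun M hM γ hγ => exists_eq_exp_add (coeffBethe_pos M n γ)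
      (abs_log_coeffBethe_sub_le hM hγ)
  · exact fun M hM γ hγ => exists_eq_exp_add (coeffSinkhorn_pos hM γ)
      (abs_log_coeffSinkhorn_sub_le hM hγ)
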